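/- Let $G$ be a bipartite simple graph with vertex set $\{1,\dots,n\}$, let $L_G=D-A$ be its Laplacian matrix ($D$ the diagonal matrix of vertex degrees, $A$ the adjacency matrix), let $\lambda\vdash n$, and let $\chi_\lambda$ be the irreducible complex character of the symmetric group $\mathfrak S_n$ indexed by $\lambda$. For an $n\times n$ matrix $M=(m_{i,j})$ put $\mathrm{imm}_\lambda(M)=\sum_{\psi\in\mathfrak S_n}\chi_\lambda(\psi)\prod_{i=1}^n m_{i,\psi(i)}$, and for $0\le r\le n$ let $b_{\lambda,r}(L_G)$ be the coefficient of $(-1)^r x^{n-r}$ in the Laplacian immanantal polynomial $\mathrm{imm}_\lambda(xI-L_G)$. A graph $H$ is obtained from $G$ by a generalized graph shift (GGS) if there are two distinct vertices $u,v$ of $G$ and a path $P$ in $G$ from $u$ to $v$ such that every interior vertex of $P$ (if any) has degree $2$ in $G$, no cycle of $G$ contains both $u$ and $v$, and $H$ arises from $G$ by moving all neighbours of $v$, except its neighbour $w$ on $P$, to $u$; that is, for every neighbour $x\ne w$ of $v$ the edge $vx$ is deleted and the edge $ux$ is added. Then for every $\lambda\vdash n$ and every $0\le r\le n$, the number $b_{\lambda,r}(L_G)$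 is a non-negative integer, and for every graph $H$ obtained from $G$ by a GGS, $b_{\lambda,r}(L_H)$ is a non-negative integer with $b_{\lambda,r}(L_H)\le b_{\lambda,r}(L_G)$. -/

import Mathlib

open Polynomial

noncomputable section

/-! ### Irreducible characters of the symmetric group

The irreducible complex representation of the symmetric group attached to a partition `lam` is the
Specht module: the subspace of the space of formal complex combinations of tabloids of shape `lam`
that is spanned by the polytabloids. With this convention `(n)` gives the trivial character and
`1ⁿ` gives the sign character. -/

/-- The Young diagram of a partition: rows in weakly decreasing order of length. A cell is a pair
`(row, column)`. -/
def Nat.Partition.diagram {n : ℕ} (lam : n.Partition) : YoungDiagram :=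
  YoungDiagram.ofRowLens (lam.parts.sort (· ≥ ·)) (lam.parts.pairwise_sort (· ≥ ·)).sortedGE

/-- A Young tableau of shape `lam ⊢ n`: a bijective filling of the cells by the `n` letters. -/
structure YoungTableau {n : ℕ} (lam : n.Partition) where
  /-- The cell that contains a given letter. -/
  cell : Fin n ≃ lam.diagram.cells

namespace YoungTableau

variable {n : ℕ} {lam : n.Partition}

/-- The row in which the letter `i` stands. -/
def row (t : YoungTableau lam) (i : Fin n) : ℕ := (t.cell i : ℕ × ℕ).1

/-- The column in which the letter `i` stands. -/
def col (t : YoungTableau lam) (i : Fin n) : ℕ := (t.cell i : ℕ × ℕ).2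

/-- A permutation acts on a tableau by replacing each letter `i` by `σ i`. -/
instance instMulAction : MulAction (Equiv.Perm (Fin n)) (YoungTableau lam) where
  smul σ t := ⟨σ.symm.trans t.cell⟩
  one_smul _ := rfl
  mul_smul _ _ _ := rfl

/-- Two tableaux are row equivalent if each letter stands in the same row in both. -/
def rowSetoid (lam : n.Partition) : Setoid (YoungTableau lam) where
  r t t' := ∀ i, t.row i = t'.row i
  iseqv := ⟨fun _ _ => rfl, fun h i => (h i).symm, fun h h' i => (h i).trans (h' i)⟩

/-- The column stabilizer of a tableau. -/
def IsColumnPerm (t : YoungTableau lam) (σ : Equiv.Perm (Fin n)) : Prop :=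
  ∀ i, t.col (σ i) = t.col i

end YoungTableau

/-- Tabloids of shape `lam`: row equivalence classes of tableaux. -/
def Tabloid {n : ℕ} (lam : n.Partition) : Type := Quotient (YoungTableau.rowSetoid lam)

/-- The tabloid of a tableau. -/
def YoungTableau.tabloid {n : ℕ} {lam : n.Partition} (t : YoungTableau lam) : Tabloid lam :=
  Quotient.mk (YoungTableau.rowSetoid lam) t

/-- The symmetric group acts on tabloids by `σ • {t} = {σ • t}`. -/
instance Tabloid.instMulAction {n : ℕ} {lam : n.Partition} :
    MulAction (Equiv.Perm (Fin n)) (Tabloid lam) where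
  smul σ := Quotient.map (σ • ·) fun _ _ h i => h (σ.symm i)
  one_smul T := by induction T using Quotient.inductionOn with | h t => rfl
  mul_smul σ τ T := by induction T using Quotient.inductionOn with | h t => rfl

open Classical in
/-- The polytabloid of `t`: the signed sum of the tabloids of `σ • t`, over the permutations `σ` in
the column stabilizer of `t`. -/
def YoungTableau.polytabloid {n : ℕ} {lam : n.Partition} (t : YoungTableau lam) :
    MonoidAlgebra ℂ (Tabloid lam) :=
  ∑ σ : Equiv.Perm (Fin n) with t.IsColumnPerm σ,
    MonoidAlgebra.single (σ • t).tabloid ((Equiv.Perm.sign σ : ℤ) : ℂ)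

theorem YoungTableau.isColumnPerm_smul_iff {n : ℕ} {lam : n.Partition} (t : YoungTableau lam)
    (g σ : Equiv.Perm (Fin n)) :
    (g • t).IsColumnPerm (g * σ * g⁻¹) ↔ t.IsColumnPerm σ := by
  have key : ∀ i, (g • t).col i = t.col (g⁻¹ i) := fun _ => rfl
  simp only [IsColumnPerm, key, Equiv.Perm.mul_apply]
  exact ⟨fun h i => by simpa using h (g i), fun h i => by simpa using h (g⁻¹ i)⟩

theorem YoungTableau.ofMulAction_polytabloid {n : ℕ} {lam : n.Partition} (t : YoungTableau lam)
    (g : Equiv.Perm (Fin n)) :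
    Representation.ofMulAction ℂ (Equiv.Perm (Fin n)) (Tabloid lam) g t.polytabloid =
      (g • t).polytabloid := by
  classical
  simp only [polytabloid, map_sum, Representation.ofMulAction_single]
  refine Finset.sum_equiv (MulAut.conj g).toEquiv (fun σ => ?_) (fun σ _ => ?_)
  · simpa using (t.isColumnPerm_smul_iff g σ).symm
  · have h1 : ((MulAut.conj g).toEquiv σ) = g * σ * g⁻¹ := rfl
    have h2 : (g * σ * g⁻¹) • g • t = g • σ • t := by simp [smul_smul]
    have h3 : Equiv.Perm.sign (g * σ * g⁻¹) = Equiv.Perm.sign σ := by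
      simp [mul_right_comm]
    rw [h1, h2, h3]
    rfl

/-- The Specht module of `lam`, as a subrepresentation of the permutation representation on
tabloids. -/
def specht {n : ℕ} (lam : n.Partition) :
    Subrepresentation
      (Representation.ofMulAction ℂ (Equiv.Perm (Fin n)) (Tabloid lam)) where
  toSubmodule := Submodule.span ℂ (Set.range YoungTableau.polytabloid)
  apply_mem_toSubmodule g v hv := by
    induction hv using Submodule.span_induction with
    | mem x hx =>
      obtain ⟨t, rfl⟩ := hx
      rw [t.ofMulAction_polytabloid]
      exact Submodule.subset_span ⟨_, rfl⟩
    | zero => simp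
    | add x y _ _ hx hy => rw [map_add]; exact Submodule.add_mem _ hx hy
    | smul a x _ hx => rw [map_smul]; exact Submodule.smul_mem _ a hx

/-- The irreducible complex character of the symmetric group indexed by `lam`. -/
def symChar {n : ℕ} (lam : n.Partition) (σ : Equiv.Perm (Fin n)) : ℂ :=
  (specht lam).toRepresentation.character σ

/-! ### Immanants and the Laplacian immanantal polynomial -/

/-- The immanant indexed by `lam ⊢ n` of an `n × n` matrix over a commutative `ℂ`-algebra. -/
def immanant {n : ℕ} (lam : n.Partition) {R : Type*} [CommRing R] [Algebra ℂ R]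
    (A : Matrix (Fin n) (Fin n) R) : R :=
  ∑ σ : Equiv.Perm (Fin n), algebraMap ℂ R (symChar lam σ) * ∏ i, A i (σ i)

/-- The Laplacian immanantal polynomial `imm_lam (x I - L_G)`. -/
def lapImmPoly {n : ℕ} (lam : n.Partition) (G : SimpleGraph (Fin n)) [DecidableRel G.Adj] : ℂ[X] :=
  immanant lam ((X : ℂ[X]) • (1 : Matrix (Fin n) (Fin n) ℂ[X]) - (G.lapMatrix ℂ).map C)

/-- For `r ≤ n`, the coefficient of `(-1)^r x^(n-r)` in the Laplacian immanantal polynomial. -/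
def lapImmCoeff {n : ℕ} (lam : n.Partition) (r : ℕ) (G : SimpleGraph (Fin n))
    [DecidableRel G.Adj] : ℂ :=
  (-1) ^ r * (lapImmPoly lam G).coeff (n - r)

/-! ### Generalized graph shift -/

namespace SimpleGraph

variable {V : Type*}

/-- The graph obtained from `G` by moving all neighbours of `v` except `w` to `u`: each edge `vx`
with `x ≠ w` is deleted and the edge `ux` is added in its place. -/
def moveNeighbors (G : SimpleGraph V) (u v w : V) : SimpleGraph V :=
  fromEdgeSet ((G.edgeSet \ {e | ∃ x ∈ G.neighborSet v \ {w}, e = s(v, x)}) ∪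
    {e | ∃ x ∈ G.neighborSet v \ {w}, e = s(u, x)})

/-- `H` is obtained from `G` by a generalized graph shift: there are distinct vertices `u` (the
recipient) and `v` (the donor) and a path from `u` to `v` all of whose interior vertices have
degree 2, no cycle of `G` contains both `u` and `v`, and `H` arises by moving all neighbours of `v`,
except the neighbour of `v` on the path, to `u`. -/
def IsGGS (G H : SimpleGraph V) : Prop :=
  ∃ (u v : V) (p : G.Walk u v), u ≠ v ∧ p.IsPath ∧
    (∀ x ∈ p.support, x ≠ u → x ≠ v → (G.neighborSet x).ncard = 2) ∧
    (∀ (a : V) (c : G.Walk a a), c.IsCycle → ¬ (u ∈ c.support ∧ v ∈ c.support)) ∧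
    H = G.moveNeighbors u v p.penultimate

end SimpleGraph

end

/-! Each diagonal entry of `xI - L_G` is `x` plus a `-1` for every neighbour, so the immanant
expands over partial self-maps `F` along edges ("arrow maps") together with the permutations whose
moved letters follow `F`. A permutation along edges of a bipartite graph moves an even number of
letters, so the sign depends only on the number `r` of arrows, and `b_{λ,r}` is the sum of
`followSum` over arrow maps with `r` arrows (`lapImmCoeff_eq_sum`). Each `followSum` is a natural
number (`exists_nat_followSum`). The permutations following `F` are the sets of cycles of `F`, and
`ψφ⁻¹` is conjugate to their symmetric difference. Hence the positive double sum of `χ(ψφ⁻¹)` is a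
positive multiple of `followSum`; integrality comes from that of the character. For the comparison,
`transfer` injects the arrow maps of `H` into those of `G`, preserving `r` and `followSum`. If `u`
points into the moved branch, the path is turned around under the branch; otherwise only arrows from
the branch to `u` are redirected to `v`. Arrows whose ends are treated inconsistently lie on no
cycle of the map, so no permutation uses them. The reflection is available because the last edge of
the path is a bridge (`isBridge`). -/

noncomputable section

/-! ### Integrality and positive definiteness of the character -/

/-- An operator that permutes a finite set of integer vectors has integral trace on their span. -/
theorem exists_int_trace_restrict_span {T V : Type*} [Finite T] [AddCommGroup V] [Module ℂ V]
    (κ : V →ₗ[ℂ] (T → ℂ)) (hκ : Function.Injective κ) {s : Set V} (hs : s.Finite)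
    (hint : ∀ x ∈ s, ∀ t, ∃ z : ℤ, κ x t = z) (f : V →ₗ[ℂ] V) (hf : Set.MapsTo f s s)
    (hW : ∀ x ∈ Submodule.span ℂ s, f x ∈ Submodule.span ℂ s) :
    ∃ z : ℤ, LinearMap.trace ℂ _ (f.restrict hW) = z := by
  classical
  -- `f` preserves this lattice. A ℤ-basis of it will be a ℂ-basis of the span, and in that basis
  -- the matrix of `f` is integral.
  let M : Submodule ℤ V := Submodule.span ℤ s
  have hint' : ∀ x ∈ M, ∀ t, ∃ z : ℤ, κ x t = z := by
    intro x hx t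
    induction hx using Submodule.span_induction with
    | mem x hx => exact hint x hx t
    | zero => exact ⟨0, by simp⟩
    | add x y _ _ hx hy =>
      obtain ⟨a, ha⟩ := hx
      obtain ⟨b, hb⟩ := hy
      exact ⟨a + b, by simp [ha, hb]⟩
    | smul a x _ hx =>
      obtain ⟨b, hb⟩ := hx
      exact ⟨a * b, by simp [hb]⟩
  have hfM : ∀ x ∈ M, f x ∈ M := by
    intro x hx
    induction hx using Submodule.span_induction with
    | mem x hx => exact Submodule.subset_span (hf hx)
    | zero => simp
    | add x y _ _ hx hy => rw [map_add]; exact M.add_mem hx hy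
    | smul a x _ hx => rw [map_zsmul]; exact M.smul_mem a hx
  have : Module.IsTorsionFree ℤ V := Module.IsTorsionFree.trans_faithfulSMul ℤ ℂ V
  have : Module.Finite ℤ M := Module.Finite.span_of_finite ℤ hs
  have : Module.Free ℤ M := Module.free_of_finite_type_torsion_free'
  let b := Module.Free.chooseBasis ℤ M
  choose v hv using fun i => hint' (b i) (b i).2
  have hvli : LinearIndependent ℤ v := by
    rw [Fintype.linearIndependent_iff]
    intro g hg
    refine Fintype.linearIndependent_iff.1 b.linearIndependent g ?_
    apply Subtype.ext
    apply hκ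
    ext t
    have h := congrArg (Int.cast : ℤ → ℂ) (congrFun hg t)
    simpa [hv] using h
  -- Integer vectors independent over ℤ stay independent over ℂ; this is where integral coordinates
  -- are needed.
  have hli : LinearIndependent ℂ (fun i => (b i : V)) := by
    have h := (linearIndependent_algebraMap_comp_iff (S := ℂ)).2 hvli
    refine LinearIndependent.of_comp κ ?_
    have hc : (κ ∘ fun i => (b i : V)) = fun i => algebraMap ℤ ℂ ∘ v i := by
      ext i t
      simp [hv]
    rw [hc]
    exact h
  have hspan : Submodule.span ℂ (Set.range fun i => (b i : V)) = Submodule.span ℂ s := by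
    apply le_antisymm
    · rw [Submodule.span_le]
      rintro _ ⟨i, rfl⟩
      exact Submodule.span_subset_span ℤ ℂ s (b i).2
    · rw [Submodule.span_le]
      intro x hx
      have h := congrArg (Subtype.val) (b.sum_repr ⟨x, Submodule.subset_span hx⟩)
      simp only [Submodule.coe_sum, Submodule.coe_smul] at h
      rw [← h]
      refine Submodule.sum_mem _ fun i _ => ?_
      rw [← Int.cast_smul_eq_zsmul ℂ]
      exact Submodule.smul_mem _ _ (Submodule.subset_span ⟨i, rfl⟩)
  let B := (Module.Basis.span hli).map (LinearEquiv.ofEq _ _ hspan)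
  have hB : ∀ i, (B i : V) = b i := fun i => by simp [B, Module.Basis.span_apply]
  refine ⟨∑ i, b.repr ⟨f (b i), hfM _ (b i).2⟩ i, ?_⟩
  rw [LinearMap.trace_eq_matrix_trace ℂ B]
  simp only [Matrix.trace, Matrix.diag, LinearMap.toMatrix_apply, Int.cast_sum]
  refine Finset.sum_congr rfl fun i _ => ?_
  have h : f.restrict hW (B i) =
      ∑ j, ((b.repr ⟨f (b i), hfM _ (b i).2⟩ j : ℤ) : ℂ) • B j := by
    apply Subtype.ext
    have h := congrArg (Subtype.val) (b.sum_repr ⟨f (b i), hfM _ (b i).2⟩)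
    simp only [Submodule.coe_sum, Submodule.coe_smul] at h
    rw [LinearMap.coe_restrict_apply, hB]
    refine h.symm.trans ?_
    simp only [Submodule.coe_sum, Submodule.coe_smul, hB]
    simp only [Int.cast_smul_eq_zsmul]
  rw [h, Module.Basis.repr_sum_self]

/-- The character of a subrepresentation of a permutation representation is positive definite. -/
theorem sum_character_mul_inv_nonneg {Γ T : Type*} [Group Γ] [Finite T] [MulAction Γ T]
    (W : Subrepresentation (Representation.ofMulAction ℂ Γ T)) (S : Finset Γ) :
    0 ≤ ∑ g ∈ S, ∑ h ∈ S, (W.toRepresentation.character (g * h⁻¹)).re := by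
  classical
  have := Fintype.ofFinite T
  let e : MonoidAlgebra ℂ T ≃ₗ[ℂ] EuclideanSpace ℂ T :=
    (MonoidAlgebra.coeffLinearEquiv ℂ).trans
      ((Finsupp.linearEquivFunOnFinite ℂ ℂ T).trans (WithLp.linearEquiv 2 ℂ (T → ℂ)).symm)
  have he : ∀ x t, e x t = x.coeff t := fun _ _ => rfl
  let ρ := Representation.ofMulAction ℂ Γ T
  -- The group permutes coordinates, so it acts unitarily.
  have hinv : ∀ g x y, inner ℂ (e x) (e (ρ g y)) = inner ℂ (e (ρ g⁻¹ x)) (e y) := by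
    intro g x y
    simp only [PiLp.inner_apply, he, ρ, Representation.coeff_ofMulAction]
    exact Fintype.sum_equiv (MulAction.toPerm g⁻¹) _ _ fun t => by simp
  let φ : W.toSubmodule ≃ₗ[ℂ] W.toSubmodule.map e.toLinearMap := e.submoduleMap W.toSubmodule
  let b := stdOrthonormalBasis ℂ (W.toSubmodule.map e.toLinearMap)
  let B := b.toBasis.map φ.symm
  have hB : ∀ i, e (B i : MonoidAlgebra ℂ T) = b i := by
    intro i
    change ((φ (B i) : _) : EuclideanSpace ℂ T) = b i
    simp [B]
  have htr : ∀ g, W.toRepresentation.character g = ∑ i, inner ℂ (e (B i)) (e (ρ g (B i))) := by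
    intro g
    rw [Representation.character, LinearMap.trace_eq_matrix_trace ℂ B]
    simp only [Matrix.trace, Matrix.diag, LinearMap.toMatrix_apply]
    refine Finset.sum_congr rfl fun i _ => ?_
    have h : B.repr (W.toRepresentation g (B i)) i =
        inner ℂ (b i) (φ (W.toRepresentation g (B i))) := by
      simp [B, OrthonormalBasis.repr_apply_apply]
    rw [h, hB, Submodule.coe_inner]
    rfl
  -- Moving `g` to the left of the inner product makes the double sum a sum of squared norms over an
  -- orthonormal basis.
  have key : ∑ g ∈ S, ∑ h ∈ S, W.toRepresentation.character (g * h⁻¹) =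
      ∑ i, inner ℂ (∑ g ∈ S, e (ρ g⁻¹ (B i))) (∑ g ∈ S, e (ρ g⁻¹ (B i))) := by
    simp only [htr, map_mul, Module.End.mul_apply, hinv, sum_inner, inner_sum]
    rw [Finset.sum_comm (s := Finset.univ)]
    rw [Finset.sum_comm (s := S)]
    exact Finset.sum_congr rfl fun h _ => Finset.sum_comm
  have hre := congrArg Complex.re key
  simp only [Complex.re_sum] at hre
  rw [hre]
  exact Finset.sum_nonneg fun i _ => inner_self_nonneg (𝕜 := ℂ)

instance {n : ℕ} (lam : n.Partition) : Finite (YoungTableau lam) :=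
  Finite.of_injective YoungTableau.cell fun ⟨_⟩ ⟨_⟩ h => by cases h; rfl

instance {n : ℕ} (lam : n.Partition) : Finite (Tabloid lam) :=
  inferInstanceAs (Finite (Quotient _))

theorem exists_int_symChar {n : ℕ} (lam : n.Partition) (σ : Equiv.Perm (Fin n)) :
    ∃ z : ℤ, symChar lam σ = z := by
  classical
  refine exists_int_trace_restrict_span
    (Finsupp.lcoeFun ∘ₗ (MonoidAlgebra.coeffLinearEquiv ℂ).toLinearMap)
    (fun x y h => ?_) (Set.finite_range YoungTableau.polytabloid) ?_
    (Representation.ofMulAction ℂ (Equiv.Perm (Fin n)) (Tabloid lam) σ) ?_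
    ((specht lam).apply_mem_toSubmodule σ)
  · exact MonoidAlgebra.coeff_injective (DFunLike.coe_injective h)
  · rintro _ ⟨t, rfl⟩ T
    refine ⟨∑ σ : Equiv.Perm (Fin n) with t.IsColumnPerm σ,
      if (σ • t).tabloid = T then (Equiv.Perm.sign σ : ℤ) else 0, ?_⟩
    simp [YoungTableau.polytabloid, MonoidAlgebra.coeff_single, Finsupp.single_apply]
  · rintro _ ⟨t, rfl⟩
    exact ⟨σ • t, (t.ofMulAction_polytabloid σ).symm⟩

theorem symChar_conj {n : ℕ} (lam : n.Partition) {σ τ : Equiv.Perm (Fin n)} (h : IsConj σ τ) :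
    symChar lam σ = symChar lam τ := by
  obtain ⟨c, rfl⟩ := isConj_iff.1 h
  rw [symChar, symChar, mul_assoc, Representation.char_mul_comm, inv_mul_cancel_right]

/-! ### Partial functions and the permutations that follow them -/

/-- A permutation follows a partial self-map `F` if it sends each letter that it moves to the value
of `F` there. -/
def Equiv.Perm.Follows {V : Type*} (F : V → Option V) (ψ : Equiv.Perm V) : Prop :=
  ∀ i, ψ i = i ∨ F i = some (ψ i)

/-- The cycles in exactly one of two permutations that follow `F` make up a third one, conjugate
to the quotient. -/
theorem Equiv.Perm.Follows.exists_symmDiff {V : Type*} [Fintype V] [DecidableEq V]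
    {F : V → Option V} {ψ φ : Equiv.Perm V} (hψ : ψ.Follows F) (hφ : φ.Follows F) :
    ∃ s : Equiv.Perm V, s.Follows F ∧ IsConj (ψ * φ⁻¹) s ∧
      ∀ i, s i = if ψ i = i then φ i else if φ i = i then ψ i else i := by
  have agree : ∀ i, ψ i ≠ i → φ i ≠ i → ψ i = φ i := fun i h1 h2 =>
    Option.some_injective _ (((hψ i).resolve_left h1).symm.trans ((hφ i).resolve_left h2))
  have closed : ∀ i, (ψ i ≠ i ∧ φ i ≠ i) → (ψ (ψ i) ≠ ψ i ∧ φ (ψ i) ≠ ψ i) := by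
    rintro i ⟨h1, h2⟩
    refine ⟨fun h => h1 (ψ.injective h), ?_⟩
    rw [agree i h1 h2]
    exact fun h => h2 (φ.injective h)
  -- The product of the cycles common to `ψ` and `φ`; dividing it out leaves disjoint permutations.
  let κ : Equiv.Perm V := Equiv.Perm.ofSubtype (ψ.subtypePermOfFintype closed)
  have κ_of : ∀ i, ψ i ≠ i → φ i ≠ i → κ i = ψ i := fun i h1 h2 =>
    Equiv.Perm.ofSubtype_apply_of_mem (p := fun i => ψ i ≠ i ∧ φ i ≠ i) _ ⟨h1, h2⟩
  have κ_not : ∀ i, ¬ (ψ i ≠ i ∧ φ i ≠ i) → κ i = i := fun i h =>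
    Equiv.Perm.ofSubtype_apply_of_not_mem (p := fun i => ψ i ≠ i ∧ φ i ≠ i) _ h
  have κ_inv_of : ∀ i, ψ i ≠ i → φ i ≠ i → ψ (κ⁻¹ i) = i ∧ φ (κ⁻¹ i) = i := by
    intro i h1 h2
    have hk : κ (κ⁻¹ i) = i := by simp
    by_cases hj : ψ (κ⁻¹ i) ≠ κ⁻¹ i ∧ φ (κ⁻¹ i) ≠ κ⁻¹ i
    · rw [κ_of _ hj.1 hj.2] at hk
      exact ⟨hk, (agree _ hj.1 hj.2).symm.trans hk⟩
    · rw [κ_not _ hj] at hk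
      rw [hk] at hj
      exact absurd ⟨h1, h2⟩ hj
  have κ_inv_not : ∀ i, ¬ (ψ i ≠ i ∧ φ i ≠ i) → κ⁻¹ i = i := fun i h => by
    rw [Equiv.Perm.inv_eq_iff_eq, κ_not i h]
  have ha : ∀ i, (ψ * κ⁻¹) i = if φ i = i then ψ i else i := by
    intro i
    rw [Equiv.Perm.mul_apply]
    by_cases h : ψ i ≠ i ∧ φ i ≠ i
    · rw [(κ_inv_of i h.1 h.2).1, if_neg h.2]
    · rw [κ_inv_not i h]
      split_ifs <;> tauto
  have hb : ∀ i, (φ * κ⁻¹) i = if ψ i = i then φ i else i := by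
    intro i
    rw [Equiv.Perm.mul_apply]
    by_cases h : ψ i ≠ i ∧ φ i ≠ i
    · rw [(κ_inv_of i h.1 h.2).2, if_neg h.1]
    · rw [κ_inv_not i h]
      split_ifs <;> tauto
  have hdisj : (ψ * κ⁻¹).Disjoint (φ * κ⁻¹) := by
    intro i
    rw [ha, hb]
    split_ifs <;> tauto
  have hs : ∀ i, (ψ * κ⁻¹ * (φ * κ⁻¹)) i =
      if ψ i = i then φ i else if φ i = i then ψ i else i := by
    intro i
    rcases hdisj i with h | h
    · rw [hdisj.commute.eq, Equiv.Perm.mul_apply (φ * κ⁻¹), h, hb]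
      rw [ha] at h
      split_ifs at h ⊢ <;> tauto
    · rw [Equiv.Perm.mul_apply (ψ * κ⁻¹), h, ha]
      rw [hb] at h
      split_ifs at h ⊢ <;> simp_all
  refine ⟨ψ * κ⁻¹ * (φ * κ⁻¹), fun i => ?_, ?_, hs⟩
  · rw [hs]
    split_ifs with h1 h2
    · exact hφ i
    · exact hψ i
    · exact Or.inl rfl
  -- Inverting one of two disjoint factors does not change the cycle type.
  · have h : ψ * φ⁻¹ = ψ * κ⁻¹ * (φ * κ⁻¹)⁻¹ := by group
    rw [h, Equiv.Perm.isConj_iff_cycleType_eq, hdisj.inv_right.cycleType_mul,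
      hdisj.cycleType_mul, Equiv.Perm.cycleType_inv]

open Classical in
/-- The sum of the character of `lam` over the permutations that follow a partial self-map. -/
def followSum {n : ℕ} (lam : n.Partition) (F : Fin n → Option (Fin n)) : ℂ :=
  ∑ ψ : Equiv.Perm (Fin n) with ψ.Follows F, symChar lam ψ

theorem exists_nat_followSum {n : ℕ} (lam : n.Partition) (F : Fin n → Option (Fin n)) :
    ∃ m : ℕ, followSum lam F = m := by
  classical
  choose z hz using exists_int_symChar lam
  let S : Finset (Equiv.Perm (Fin n)) := {ψ | ψ.Follows F}
  have hS : ∀ ψ, ψ ∈ S ↔ ψ.Follows F := fun ψ => by simp [S]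
  have hsum : followSum lam F = ((∑ ψ ∈ S, z ψ : ℤ) : ℂ) := by
    simp [followSum, S, hz]
  have hcard : 0 < S.card := Finset.card_pos.2 ⟨1, (hS 1).2 fun i => Or.inl rfl⟩
  -- Symmetric difference with a fixed `φ` is an injection of the finite set `S` into itself, hence
  -- a bijection.
  have hrow : ∀ φ ∈ S, ∑ ψ ∈ S, z (ψ * φ⁻¹) = ∑ ψ ∈ S, z ψ := by
    intro φ hφ
    choose! s hs using fun ψ (hψ : ψ ∈ S) =>
      Equiv.Perm.Follows.exists_symmDiff ((hS ψ).1 hψ) ((hS φ).1 hφ)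
    have hmaps : Set.MapsTo s S S := fun ψ hψ => (hS _).2 (hs ψ hψ).1
    have hinj : Set.InjOn s S := by
      intro ψ hψ ψ' hψ' h
      ext1 i
      have h1 := (hs ψ hψ).2.2 i
      have h2 := (hs ψ' hψ').2.2 i
      have h3 := hφ
      rw [← h, h1] at h2
      have a1 := ((hS ψ).1 hψ) i
      have a2 := ((hS ψ').1 hψ') i
      have a3 := ((hS φ).1 hφ) i
      grind
    refine Finset.sum_nbij s hmaps hinj
      (Finset.surjOn_of_injOn_of_card_le s hmaps hinj le_rfl) fun ψ hψ => ?_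
    have h := symChar_conj lam (hs ψ hψ).2.1
    rw [hz, hz] at h
    exact_mod_cast h
  have hpos : (0 : ℤ) ≤ S.card * ∑ ψ ∈ S, z ψ := by
    have h := sum_character_mul_inv_nonneg (specht lam) S
    have h' : ∀ g, (specht lam).toRepresentation.character g = z g := hz
    simp only [h', Complex.intCast_re] at h
    rw [Finset.sum_comm] at h
    norm_cast at h
    rw [Finset.sum_congr rfl hrow, Finset.sum_const, nsmul_eq_mul] at h
    exact h
  have hnn : 0 ≤ ∑ ψ ∈ S, z ψ := nonneg_of_mul_nonneg_right hpos (by exact_mod_cast hcard)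
  obtain ⟨m, hm⟩ := Int.eq_ofNat_of_zero_le hnn
  exact ⟨m, by rw [hsum, hm]; simp⟩

/-! ### The coefficient formula -/

/-- With `s = ±1` according to colour, each factor is `s i * s (σ i)`, so every `s i` occurs twice
in the product. -/
theorem prod_ite_fixed_eq_one {n : ℕ} {G : SimpleGraph (Fin n)} (hG : G.IsBipartite)
    (R : Type*) [CommRing R] (σ : Equiv.Perm (Fin n)) (hσ : ∀ i, σ i = i ∨ G.Adj i (σ i)) :
    ∏ i, (if σ i = i then 1 else -1 : R) = 1 := by
  obtain ⟨c⟩ := hG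
  let s : Fin n → R := fun i => if c i = 0 then 1 else -1
  have hs : ∀ i, s i * s i = 1 := fun i => by simp only [s]; split_ifs <;> simp
  have hst : ∀ i, (if σ i = i then 1 else -1 : R) = s i * s (σ i) := by
    intro i
    split_ifs with h
    · rw [h, hs]
    · have h' := c.valid ((hσ i).resolve_left h)
      simp only [s]
      have : c i = 0 ↔ c (σ i) ≠ 0 := by omega
      by_cases h0 : c i = 0
      · simp [h0, this.1 h0]
      · have : c (σ i) = 0 := by omega
        simp [h0, this]
  simp only [hst, Finset.prod_mul_distrib]
  rw [Equiv.prod_comp σ s, ← Finset.prod_mul_distrib]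
  simp [hs]

/-- The contribution of a choice `o` at `i` to the entry `(i, σ i)` of `x I - L_G`. -/
def arrowTerm {n : ℕ} (G : SimpleGraph (Fin n)) [DecidableRel G.Adj] (σ : Equiv.Perm (Fin n))
    (i : Fin n) : Option (Fin n) → ℂ[X]
  | none => if σ i = i then X else 0
  | some j => if G.Adj i j then if σ i = i then -1 else if σ i = j then 1 else 0 else 0

theorem sum_arrowTerm {n : ℕ} (G : SimpleGraph (Fin n)) [DecidableRel G.Adj]
    (σ : Equiv.Perm (Fin n)) (i : Fin n) :
    ((X : ℂ[X]) • (1 : Matrix (Fin n) (Fin n) ℂ[X]) - (G.lapMatrix ℂ).map C) i (σ i) =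
      ∑ o, arrowTerm G σ i o := by
  rw [Fintype.sum_option]
  by_cases h : σ i = i
  · simp [arrowTerm, h, SimpleGraph.lapMatrix, SimpleGraph.degMatrix, Finset.sum_ite, sub_eq_add_neg,
      ← SimpleGraph.card_neighborFinset_eq_degree, SimpleGraph.neighborFinset_eq_filter]
  · simp [arrowTerm, h, SimpleGraph.lapMatrix, SimpleGraph.degMatrix,
      Ne.symm h]
    rw [Finset.sum_eq_single (σ i) (fun j _ hj => by simp [hj.symm]) (by simp)]
    simp

/-- The partial self-maps along the edges of `G` with exactly `r` arrows. -/
def arrowMaps {n : ℕ} (G : SimpleGraph (Fin n)) (r : ℕ) : Set (Fin n → Option (Fin n)) :=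
  {F | (∀ i j, F i = some j → G.Adj i j) ∧ {i | F i ≠ none}.ncard = r}

/-- An arrow contributes `-1` at a fixed letter and `1` at a moved one. Counting `-1` for every
arrow is corrected by a `-1` for every moved letter, and these cancel by bipartiteness. -/
theorem prod_arrowTerm {n : ℕ} {G : SimpleGraph (Fin n)} [DecidableRel G.Adj]
    (hG : G.IsBipartite) (σ : Equiv.Perm (Fin n)) {F : Fin n → Option (Fin n)}
    (hF : ∀ i j, F i = some j → G.Adj i j) (hσ : σ.Follows F) :
    ∏ i, arrowTerm G σ i (F i) =
      C ((-1) ^ {i | F i ≠ none}.ncard) * X ^ (n - {i | F i ≠ none}.ncard) := by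
  have hterm : ∀ i, arrowTerm G σ i (F i) = (if F i ≠ none then -1 else 1) *
      (if ¬ F i ≠ none then X else 1) * (if σ i = i then 1 else -1) := by
    intro i
    cases h : F i with
    | none =>
      have := (hσ i).resolve_right (by simp [h])
      simp [arrowTerm, this]
    | some j =>
      by_cases h' : σ i = i
      · simp [arrowTerm, h', hF i j h]
      · have h2 := (hσ i).resolve_left h'
        rw [h, Option.some_inj] at h2
        simp [arrowTerm, hF i j h, h2.symm]
  have hcard : {i | F i ≠ none}.ncard = (Finset.univ.filter fun i => F i ≠ none).card := by
    rw [← Set.ncard_coe_finset]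
    simp
  have hcard' : (Finset.univ.filter fun i => ¬ F i ≠ none).card =
      n - (Finset.univ.filter fun i => F i ≠ none).card := by
    rw [Finset.filter_not, Finset.card_sdiff_of_subset (Finset.filter_subset _ _),
      Finset.card_univ, Fintype.card_fin]
  simp only [hterm, Finset.prod_mul_distrib]
  rw [prod_ite_fixed_eq_one hG ℂ[X] σ fun i => (hσ i).imp_right (hF i _), mul_one,
    ← Finset.prod_filter, ← Finset.prod_filter, Finset.prod_const, Finset.prod_const,
    hcard', hcard]
  simp only [map_pow, map_neg, map_one]

theorem prod_arrowTerm_eq_zero {n : ℕ} (G : SimpleGraph (Fin n)) [DecidableRel G.Adj]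
    (σ : Equiv.Perm (Fin n)) {F : Fin n → Option (Fin n)}
    (h : ¬ ((∀ i j, F i = some j → G.Adj i j) ∧ σ.Follows F)) :
    ∏ i, arrowTerm G σ i (F i) = 0 := by
  rw [Classical.not_and_iff_not_or_not] at h
  rcases h with h | h
  · push Not at h
    obtain ⟨i, j, hij, hadj⟩ := h
    exact Finset.prod_eq_zero (Finset.mem_univ i) (by simp [arrowTerm, hij, hadj])
  · unfold Equiv.Perm.Follows at h
    push Not at h
    obtain ⟨i, hi, hne⟩ := h
    refine Finset.prod_eq_zero (Finset.mem_univ i) ?_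
    cases h' : F i with
    | none => simp [arrowTerm, hi]
    | some j =>
      rw [h', Ne, Option.some_inj] at hne
      simp [arrowTerm, hi, Ne.symm hne]

open Classical in
theorem lapImmCoeff_eq_sum {n : ℕ} {G : SimpleGraph (Fin n)} [DecidableRel G.Adj]
    (hG : G.IsBipartite) (lam : n.Partition) {r : ℕ} (hr : r ≤ n) :
    lapImmCoeff lam r G = ∑ F ∈ (arrowMaps G r).toFinset, followSum lam F := by
  have hprod : ∀ σ : Equiv.Perm (Fin n), ∀ F : Fin n → Option (Fin n),
      (-1) ^ r * (symChar lam σ * (∏ i, arrowTerm G σ i (F i)).coeff (n - r)) =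
        if F ∈ arrowMaps G r ∧ σ.Follows F then symChar lam σ else 0 := by
    intro σ F
    by_cases h : (∀ i j, F i = some j → G.Adj i j) ∧ σ.Follows F
    · have hle : {i | F i ≠ none}.ncard ≤ n := by
        simpa using Set.ncard_le_card {i | F i ≠ none}
      rw [prod_arrowTerm hG σ h.1 h.2, coeff_C_mul, coeff_X_pow]
      by_cases hc : {i | F i ≠ none}.ncard = r
      · rw [hc, if_pos rfl, if_pos ⟨⟨h.1, hc⟩, h.2⟩, mul_one, mul_comm (symChar lam σ), ← mul_assoc,
          ← mul_pow]
        simp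
      · rw [if_neg (by omega), if_neg (fun h' => hc h'.1.2)]
        simp
    · rw [prod_arrowTerm_eq_zero G σ h, if_neg fun h' => h ⟨h'.1.1, h'.2⟩]
      simp
  rw [lapImmCoeff, lapImmPoly, immanant, finsetSum_coeff, Finset.mul_sum]
  have hσ : ∀ σ : Equiv.Perm (Fin n), (-1) ^ r * (algebraMap ℂ ℂ[X] (symChar lam σ) *
      ∏ i, ((X : ℂ[X]) • (1 : Matrix (Fin n) (Fin n) ℂ[X]) - (G.lapMatrix ℂ).map C) i
        (σ i)).coeff (n - r) =
      ∑ F : Fin n → Option (Fin n),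
        if F ∈ arrowMaps G r ∧ σ.Follows F then symChar lam σ else 0 := by
    intro σ
    simp only [sum_arrowTerm]
    rw [Finset.prod_univ_sum, Fintype.piFinset_univ, ← C_eq_algebraMap, coeff_C_mul,
      finsetSum_coeff, Finset.mul_sum, Finset.mul_sum]
    exact Finset.sum_congr rfl fun F _ => hprod σ F
  rw [Finset.sum_congr rfl fun σ _ => hσ σ, Finset.sum_comm]
  simp only [followSum, Finset.sum_filter, ite_and, Finset.sum_ite_irrel, Finset.sum_const_zero]
  rw [← Finset.sum_filter]
  refine Finset.sum_congr ?_ fun _ _ => rfl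
  ext F
  simp

/-! ### Comparing arrow maps of a graph and its shift -/

/-- A permutation of a finite set that maps the complement of `Y` into itself maps it onto itself,
so it never uses an arrow leaving `Y`. Such arrows may be altered freely. -/
theorem Equiv.Perm.Follows.of_invariant {V : Type*} [Finite V] {F F' : V → Option V} {Y : Set V}
    (hF : ∀ i ∉ Y, ∀ j, F i = some j → j ∉ Y)
    (hFF' : ∀ i j, F i = some j → F' i = some j ∨ (i ∈ Y ∧ j ∉ Y))
    {ψ : Equiv.Perm V} (hψ : ψ.Follows F) : ψ.Follows F' := by
  have hmaps : Set.MapsTo ψ Yᶜ Yᶜ := fun i hi => by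
    rcases hψ i with h | h
    · rwa [h]
    · exact hF i hi _ h
  intro i
  rcases hψ i with h | h
  · exact Or.inl h
  · rcases hFF' i _ h with h' | ⟨hi, hj⟩
    · exact Or.inr h'
    · have h' := Equiv.Perm.perm_symm_mapsTo_of_mapsTo ψ hmaps (show ψ i ∈ Yᶜ from hj)
      rw [Equiv.symm_apply_apply] at h'
      exact absurd hi h'

theorem followSum_congr {n : ℕ} (lam : n.Partition) {F F' : Fin n → Option (Fin n)}
    (h : ∀ ψ : Equiv.Perm (Fin n), ψ.Follows F ↔ ψ.Follows F') :
    followSum lam F = followSum lam F' := by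
  classical
  exact Finset.sum_congr (Finset.filter_congr fun ψ _ => h ψ) fun _ _ => rfl

/-- Conjugation by `ρ` matches the two sets of permutations, and the character is a class function.
-/
theorem followSum_relabel {n : ℕ} (lam : n.Partition) (F : Fin n → Option (Fin n))
    {ρ : Equiv.Perm (Fin n)} (hρ : ∀ i, ρ (ρ i) = i) :
    followSum lam (fun i => (F (ρ i)).map ρ) = followSum lam F := by
  classical
  have hinv : ρ⁻¹ = ρ := by
    ext1 i
    rw [Equiv.Perm.inv_eq_iff_eq, hρ]
  have key : ∀ ψ : Equiv.Perm (Fin n),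
      (ρ * ψ * ρ⁻¹).Follows (fun i => (F (ρ i)).map ρ) ↔ ψ.Follows F := by
    intro ψ
    simp only [Equiv.Perm.Follows, hinv, Equiv.Perm.mul_apply]
    constructor
    · intro h i
      have := h (ρ i)
      simpa [hρ] using this
    · intro h i
      rcases h (ρ i) with h | h
      · left
        rw [h, hρ]
      · right
        rw [h, Option.map_some]
  refine (Finset.sum_equiv (MulAut.conj ρ).toEquiv (fun ψ => ?_) fun ψ _ => ?_).symm
  · simpa using (key ψ).symm
  · exact symChar_conj lam (isConj_iff.2 ⟨ρ, rfl⟩)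

/-- `H` arises from `G` by moving the branch `Y` from the end `v` to the end `u` of the segment `P`,
which the involution `ρ` turns around. -/
structure IsBranchShift {V : Type*} (G H : SimpleGraph V) (u v : V) (P Y : Set V)
    (ρ : Equiv.Perm V) : Prop where
  left_mem : u ∈ P
  right_mem : v ∈ P
  notMem : ∀ i ∈ P, i ∉ Y
  involutive : ∀ i, ρ (ρ i) = i
  map_left : ρ u = v
  map_mem : ∀ i ∈ P, ρ i ∈ P
  map_eq : ∀ i ∉ P, ρ i = i
  adj_map : ∀ i ∈ P, ∀ j ∈ P, G.Adj i j → G.Adj (ρ i) (ρ j)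
  adj_leave : ∀ i ∈ P, ∀ j ∉ P, G.Adj i j → (i = u ∧ j ∉ Y) ∨ (i = v ∧ j ∈ Y)
  adj_out : ∀ i ∉ Y, ∀ j ∉ Y, H.Adj i j → G.Adj i j
  adj_in : ∀ i ∈ Y, ∀ j ∈ Y, H.Adj i j → G.Adj i j
  adj_cross : ∀ i ∈ Y, ∀ j ∉ Y, H.Adj i j → j = u ∧ G.Adj i v

namespace IsBranchShift

variable {n : ℕ} {G H : SimpleGraph (Fin n)} {u v : Fin n} {P Y : Set (Fin n)}
  {ρ : Equiv.Perm (Fin n)}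

open Classical in
/-- The map from arrow maps of the shifted graph to arrow maps of the original one. -/
def transfer (u : Fin n) (P Y : Set (Fin n)) (ρ : Equiv.Perm (Fin n))
    (F : Fin n → Option (Fin n)) (i : Fin n) : Option (Fin n) :=
  -- Reflection would spoil an arrow from `u` to a vertex outside both segment and branch; here the
  -- only arrow at `u` enters the branch.
  if ∃ y ∈ Y, F u = some y then
    if i ∉ P ∧ i ∉ Y then F i else (F (ρ i)).map ρ
  else if i ∈ Y then (F i).map ρ else F i

theorem map_right (h : IsBranchShift G H u v P Y ρ) : ρ v = u := by
  rw [← h.map_left, h.involutive]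

theorem map_branch (h : IsBranchShift G H u v P Y ρ) {i : Fin n} (hi : i ∈ Y) : ρ i = i :=
  h.map_eq i fun hP => h.notMem i hP hi

/-- Arrows of the shifted graph enter the branch only from `u`. -/
theorem notMem_of_adj (h : IsBranchShift G H u v P Y ρ) {i j : Fin n} (hi : i ∉ Y) (hiu : i ≠ u)
    (hij : H.Adj i j) : j ∉ Y :=
  fun hj => hiu (h.adj_cross j hj i hi hij.symm).1

theorem transfer_adj (h : IsBranchShift G H u v P Y ρ) {F : Fin n → Option (Fin n)}
    (hF : ∀ i j, F i = some j → H.Adj i j) {i j : Fin n} (hij : transfer u P Y ρ F i = some j) :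
    G.Adj i j := by
  have hu := h.notMem u h.left_mem
  have branch : ∀ i ∈ Y, (F i).map ρ = some j → G.Adj i j := by
    intro i hi hj
    obtain ⟨b, hb, rfl⟩ := Option.map_eq_some_iff.1 hj
    by_cases hbY : b ∈ Y
    · rw [h.map_branch hbY]
      exact h.adj_in i hi b hbY (hF _ _ hb)
    · obtain ⟨rfl, h'⟩ := h.adj_cross i hi b hbY (hF _ _ hb)
      rwa [h.map_left]
  unfold transfer at hij
  split_ifs at hij with h1 h2 h3
  · obtain ⟨y, hy, huy⟩ := h1
    have hiu : i ≠ u := by rintro rfl; exact h2.1 h.left_mem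
    exact h.adj_out i h2.2 j (h.notMem_of_adj h2.2 hiu (hF _ _ hij)) (hF _ _ hij)
  · obtain ⟨y, hy, huy⟩ := h1
    by_cases hiY : i ∈ Y
    · rw [h.map_branch hiY] at hij
      exact branch i hiY hij
    have hiP : i ∈ P := by tauto
    obtain ⟨b, hb, rfl⟩ := Option.map_eq_some_iff.1 hij
    by_cases hu' : ρ i = u
    · have hiv : i = v := by rw [← h.map_left, ← hu', h.involutive]
      rw [hu', huy, Option.some_inj] at hb
      subst hb
      rw [h.map_branch hy, hiv]
      exact (h.adj_cross y hy u hu (hF _ _ huy).symm).2.symm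
    have hi' := h.map_mem i hiP
    have hbY := h.notMem_of_adj (h.notMem _ hi') hu' (hF _ _ hb)
    have hadj := h.adj_out _ (h.notMem _ hi') b hbY (hF _ _ hb)
    by_cases hbP : b ∈ P
    · have := h.adj_map _ hi' b hbP hadj
      rwa [h.involutive] at this
    · rcases h.adj_leave _ hi' b hbP hadj with h' | h'
      · exact absurd h'.1 hu'
      · exact absurd h'.2 hbY
  · exact branch i h3 hij
  · have hjY : j ∉ Y := by
      by_cases hiu : i = u
      · subst hiu
        exact fun hj => h1 ⟨j, hj, hij⟩
      · exact h.notMem_of_adj h3 hiu (hF _ _ hij)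
    exact h.adj_out i h3 j hjY (hF _ _ hij)

theorem ncard_transfer (h : IsBranchShift G H u v P Y ρ) (F : Fin n → Option (Fin n)) :
    {i | transfer u P Y ρ F i ≠ none}.ncard = {i | F i ≠ none}.ncard := by
  by_cases h1 : ∃ y ∈ Y, F u = some y
  · have hset : {i | transfer u P Y ρ F i ≠ none} = ρ '' {i | F i ≠ none} := by
      ext i
      rw [Equiv.image_eq_preimage_symm]
      have hsymm : ρ.symm i = ρ i := by rw [Equiv.symm_apply_eq, h.involutive]
      simp only [Set.mem_ofPred_eq, Set.mem_preimage, transfer, if_pos h1, hsymm]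
      split_ifs with h2
      · rw [h.map_eq i h2.1]
      · simp
    rw [hset, Set.ncard_image_of_injective _ ρ.injective]
  · congr 1
    ext i
    simp only [Set.mem_ofPred_eq, transfer, if_neg h1]
    split_ifs <;> simp

theorem transfer_mem (h : IsBranchShift G H u v P Y ρ) {r : ℕ} {F : Fin n → Option (Fin n)}
    (hF : F ∈ arrowMaps H r) : transfer u P Y ρ F ∈ arrowMaps G r :=
  ⟨fun _ _ => h.transfer_adj hF.1, by rw [h.ncard_transfer, hF.2]⟩

/-- The image reveals which case of `transfer` was applied, as injectivity requires. -/
theorem transfer_right_mem_iff (h : IsBranchShift G H u v P Y ρ) (huv : u ≠ v)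
    {F : Fin n → Option (Fin n)} (hF : ∀ i j, F i = some j → H.Adj i j) :
    (∃ y ∈ Y, transfer u P Y ρ F v = some y) ↔ ∃ y ∈ Y, F u = some y := by
  have hv := h.notMem v h.right_mem
  constructor
  · rintro ⟨y, hy, hvy⟩
    by_contra h1
    rw [transfer, if_neg h1, if_neg hv] at hvy
    exact h.notMem_of_adj hv huv.symm (hF _ _ hvy) hy
  · rintro ⟨y, hy, huy⟩
    refine ⟨y, hy, ?_⟩
    rw [transfer, if_pos ⟨y, hy, huy⟩, if_neg fun h' => h'.1 h.right_mem, h.map_right, huy,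
      Option.map_some, h.map_branch hy]

theorem transfer_injOn (h : IsBranchShift G H u v P Y ρ) (huv : u ≠ v) (r : ℕ) :
    Set.InjOn (transfer u P Y ρ) (arrowMaps H r) := by
  intro F hF F' hF' heq
  have hiff := h.transfer_right_mem_iff huv hF.1
  rw [heq, h.transfer_right_mem_iff huv hF'.1] at hiff
  have hmap := Option.map_injective ρ.injective
  by_cases h1 : ∃ y ∈ Y, F u = some y
  · have h1' := hiff.2 h1
    ext1 i
    have hi := congrFun heq (ρ i)
    simp only [transfer, if_pos h1, if_pos h1', h.involutive] at hi
    by_cases hX : i ∉ P ∧ i ∉ Y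
    · rwa [h.map_eq i hX.1, if_pos hX, if_pos hX] at hi
    · have hX' : ¬ (ρ i ∉ P ∧ ρ i ∉ Y) := by
        by_cases hP : i ∈ P
        · exact fun h' => h'.1 (h.map_mem i hP)
        · rwa [h.map_eq i hP]
      rw [if_neg hX', if_neg hX'] at hi
      exact hmap hi
  · have h1' := fun h' => h1 (hiff.1 h')
    ext1 i
    have hi := congrFun heq i
    simp only [transfer, if_neg h1, if_neg h1'] at hi
    split_ifs at hi
    · exact hmap hi
    · exact hi

theorem followSum_transfer (h : IsBranchShift G H u v P Y ρ) (lam : n.Partition)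
    {F : Fin n → Option (Fin n)} (hF : ∀ i j, F i = some j → H.Adj i j) :
    followSum lam (transfer u P Y ρ F) = followSum lam F := by
  have hu := h.notMem u h.left_mem
  have hv := h.notMem v h.right_mem
  by_cases h1 : ∃ y ∈ Y, F u = some y
  · obtain ⟨y, hy, huy⟩ := id h1
    rw [← followSum_relabel lam F h.involutive]
    -- No arrow leaves `P ∪ Y`, since the one at `u` enters the branch. Thus `transfer` and the
    -- relabelled map differ only on unused arrows entering `P ∪ Y`.
    have hinv : ∀ i ∉ (P ∪ Y)ᶜ, ∀ j, (F (ρ i)).map ρ = some j → j ∉ (P ∪ Y)ᶜ := by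
      intro i hi j hij
      simp only [Set.mem_compl_iff, not_not, Set.mem_union] at hi ⊢
      obtain ⟨b, hb, rfl⟩ := Option.map_eq_some_iff.1 hij
      by_cases hbP : b ∈ P
      · exact Or.inl (h.map_mem b hbP)
      rw [h.map_eq b hbP]
      by_contra hb'
      have hbY : b ∉ Y := fun h' => hb' (Or.inr h')
      rcases hi with hi | hi
      · have hi' := h.map_mem i hi
        have hadj := h.adj_out _ (h.notMem _ hi') b hbY (hF _ _ hb)
        rcases h.adj_leave _ hi' b hbP hadj with h' | h'
        · rw [h'.1, huy, Option.some_inj] at hb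
          exact hbY (hb ▸ hy)
        · exact hbY h'.2
      · rw [h.map_branch hi] at hb
        exact hbP ((h.adj_cross i hi b hbY (hF _ _ hb)).1 ▸ h.left_mem)
    have htr : ∀ i ∉ (P ∪ Y)ᶜ, transfer u P Y ρ F i = (F (ρ i)).map ρ := by
      intro i hi
      simp only [Set.mem_compl_iff, not_not, Set.mem_union] at hi
      rw [transfer, if_pos h1, if_neg (by tauto)]
    have htr' : ∀ i ∈ (P ∪ Y)ᶜ, transfer u P Y ρ F i = F i ∧ (F (ρ i)).map ρ = (F i).map ρ := by
      intro i hi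
      simp only [Set.mem_compl_iff, Set.mem_union, not_or] at hi
      exact ⟨by rw [transfer, if_pos h1, if_pos hi], by rw [h.map_eq i hi.1]⟩
    have hnot : ∀ j, ρ j ≠ j → ρ j ∉ (P ∪ Y)ᶜ ∧ j ∉ (P ∪ Y)ᶜ := by
      intro j hj
      have hjP : j ∈ P := by
        by_contra h'
        exact hj (h.map_eq j h')
      simp [hjP, h.map_mem j hjP]
    refine followSum_congr lam fun ψ => ⟨Equiv.Perm.Follows.of_invariant (Y := (P ∪ Y)ᶜ) ?_ ?_,
      Equiv.Perm.Follows.of_invariant (Y := (P ∪ Y)ᶜ) hinv ?_⟩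
    · intro i hi j hij
      rw [htr i hi] at hij
      exact hinv i hi j hij
    · intro i j hij
      by_cases hi : i ∈ (P ∪ Y)ᶜ
      · rw [(htr' i hi).1] at hij
        rw [(htr' i hi).2, hij, Option.map_some]
        by_cases hj : ρ j = j
        · exact Or.inl (by rw [hj])
        · exact Or.inr ⟨hi, (hnot j hj).2⟩
      · exact Or.inl (by rw [← htr i hi, hij])
    · intro i j hij
      by_cases hi : i ∈ (P ∪ Y)ᶜ
      · rw [(htr' i hi).2] at hij
        rw [(htr' i hi).1]
        obtain ⟨b, hb, rfl⟩ := Option.map_eq_some_iff.1 hij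
        by_cases hj : ρ b = b
        · exact Or.inl (by rw [hj, hb])
        · exact Or.inr ⟨hi, (hnot b hj).1⟩
      · exact Or.inl (by rw [htr i hi, hij])
  -- No arrow enters the branch, so the redirected arrows, which leave it, are unused.
  · have hinv : ∀ i ∉ Y, ∀ j, F i = some j → j ∉ Y := by
      intro i hi j hij
      by_cases hiu : i = u
      · subst hiu
        exact fun hj => h1 ⟨j, hj, hij⟩
      · exact h.notMem_of_adj hi hiu (hF _ _ hij)
    have htr : ∀ i ∉ Y, transfer u P Y ρ F i = F i := fun i hi => by
      rw [transfer, if_neg h1, if_neg hi]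
    have htr' : ∀ i ∈ Y, transfer u P Y ρ F i = (F i).map ρ := fun i hi => by
      rw [transfer, if_neg h1, if_pos hi]
    refine followSum_congr lam fun ψ => ⟨Equiv.Perm.Follows.of_invariant (Y := Y) ?_ ?_,
      Equiv.Perm.Follows.of_invariant (Y := Y) hinv ?_⟩
    · intro i hi j hij
      rw [htr i hi] at hij
      exact hinv i hi j hij
    · intro i j hij
      by_cases hi : i ∈ Y
      · rw [htr' i hi] at hij
        obtain ⟨b, hb, rfl⟩ := Option.map_eq_some_iff.1 hij
        by_cases hbY : b ∈ Y
        · exact Or.inl (by rw [h.map_branch hbY, hb])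
        · rw [(h.adj_cross i hi b hbY (hF _ _ hb)).1, h.map_left]
          exact Or.inr ⟨hi, hv⟩
      · exact Or.inl (by rw [← htr i hi, hij])
    · intro i j hij
      by_cases hi : i ∈ Y
      · rw [htr' i hi, hij, Option.map_some]
        by_cases hjY : j ∈ Y
        · exact Or.inl (by rw [h.map_branch hjY])
        · exact Or.inr ⟨hi, hjY⟩
      · exact Or.inl (by rw [htr i hi, hij])

open Classical in
theorem exists_nat_sum_followSum_le (h : IsBranchShift G H u v P Y ρ) (huv : u ≠ v)
    (lam : n.Partition) (r : ℕ) :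
    ∃ b b' : ℕ, ∑ F ∈ (arrowMaps G r).toFinset, followSum lam F = b ∧
      ∑ F ∈ (arrowMaps H r).toFinset, followSum lam F = b' ∧ b' ≤ b := by
  choose m hm using exists_nat_followSum lam
  refine ⟨∑ F ∈ (arrowMaps G r).toFinset, m F, ∑ F ∈ (arrowMaps H r).toFinset, m F,
    by simp [hm], by simp [hm], ?_⟩
  have hm' : ∀ F ∈ (arrowMaps H r).toFinset, m F = m (transfer u P Y ρ F) := by
    intro F hF
    have := h.followSum_transfer lam (Set.mem_toFinset.1 hF).1
    rw [hm, hm] at this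
    exact_mod_cast this.symm
  rw [Finset.sum_congr rfl hm', ← Finset.sum_image (f := m) (g := transfer u P Y ρ)
    (by simpa using h.transfer_injOn huv r)]
  refine Finset.sum_le_sum_of_subset fun F hF => ?_
  obtain ⟨F', hF', rfl⟩ := Finset.mem_image.1 hF
  exact Set.mem_toFinset.2 (h.transfer_mem (Set.mem_toFinset.1 hF'))

end IsBranchShift

/-! ### The branch moved by a generalized graph shift -/

namespace SimpleGraph

variable {V : Type*} {G : SimpleGraph V} {u v : V}

/-- A cycle uses two neighbours of each of its vertices, hence all of them at a vertex of degree 2.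
-/
theorem Walk.IsCycle.mem_support_of_adj_of_ncard_eq_two {a x y : V} {c : G.Walk a a}
    (hc : c.IsCycle) (hx : x ∈ c.support) (hdeg : (G.neighborSet x).ncard = 2) (hxy : G.Adj x y) :
    y ∈ c.support := by
  have hfin : (G.neighborSet x).Finite := Set.finite_of_ncard_ne_zero (by omega)
  have h := Set.eq_of_subset_of_ncard_le (c.toSubgraph.neighborSet_subset x)
    (by rw [hdeg, hc.ncard_neighborSet_toSubgraph_eq_two hx]) hfin
  have hy : y ∈ c.toSubgraph.neighborSet x := h ▸ hxy
  exact (Walk.mem_verts_toSubgraph c).1 (c.toSubgraph.edge_vert (SimpleGraph.Subgraph.Adj.symm hy))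

/-- The branch at `v` away from its neighbour `w`. -/
def branch (G : SimpleGraph V) (v w : V) : Set V :=
  {y | y ≠ v ∧ (G.deleteEdges {s(v, w)}).Reachable v y}

open Classical in
/-- The map that turns a walk around and fixes everything off the walk. -/
def Walk.flip (p : G.Walk u v) (x : V) : V :=
  if x ∈ p.support then p.getVert (p.length - p.support.idxOf x) else x

theorem mem_branch_of_adj {w x : V} (hx : G.Adj v x) (hw : x ≠ w) :
    x ∈ G.branch v w := by
  refine ⟨hx.ne', Adj.reachable ?_⟩
  rw [deleteEdges_adj]
  refine ⟨hx, fun he => hw ?_⟩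
  exact Sym2.congr_right.1 he

theorem mem_branch_of_adj_branch {w x y : V} (hx : x ∈ G.branch v w)
    (hy : y ≠ v) (hxy : G.Adj x y) : y ∈ G.branch v w := by
  refine ⟨hy, hx.2.trans (Adj.reachable ?_)⟩
  rw [deleteEdges_adj]
  refine ⟨hxy, fun he => ?_⟩
  have hv : v ∈ s(x, y) := by
    rw [Set.mem_singleton_iff.1 he]
    exact Sym2.mem_mk_left _ _
  rcases Sym2.mem_iff.1 hv with hv | hv
  · exact hx.1 hv.symm
  · exact hy hv.symm

namespace Walk

variable {p : G.Walk u v}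

theorem adj_getVert_pred (p : G.Walk u v) {i : ℕ} (h0 : 0 < i) (hi : i ≤ p.length) :
    G.Adj (p.getVert i) (p.getVert (i - 1)) := by
  have := p.adj_getVert_succ (i := i - 1) (by omega)
  rw [Nat.sub_add_cancel h0] at this
  exact this.symm

theorem IsPath.getVert_inj (hp : p.IsPath) {i j : ℕ} (hi : i ≤ p.length) (hj : j ≤ p.length)
    (h : p.getVert i = p.getVert j) : i = j :=
  hp.getVert_injOn hi hj h

theorem exists_getVert_eq {x : V} (hx : x ∈ p.support) : ∃ i ≤ p.length, p.getVert i = x := by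
  obtain ⟨i, rfl, hi⟩ := mem_support_iff_exists_getVert.1 hx
  exact ⟨i, hi, rfl⟩

theorem IsPath.flip_getVert (hp : p.IsPath) {i : ℕ} (hi : i ≤ p.length) :
    p.flip (p.getVert i) = p.getVert (p.length - i) := by
  classical
  have hmem := p.getVert_mem_support i
  rw [flip, if_pos hmem]
  have hlt : p.support.idxOf (p.getVert i) < p.support.length := List.idxOf_lt_length_iff.2 hmem
  have hle : p.support.idxOf (p.getVert i) ≤ p.length := by
    rw [length_support] at hlt
    omega
  have h := List.getElem_idxOf hlt
  rw [support_getElem_eq_getVert] at h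
  rw [hp.getVert_inj hle hi h]

theorem flip_eq_self {x : V} (hx : x ∉ p.support) : p.flip x = x := if_neg hx

theorem IsPath.flip_mem (hp : p.IsPath) {x : V} (hx : x ∈ p.support) : p.flip x ∈ p.support := by
  obtain ⟨i, hi, rfl⟩ := exists_getVert_eq hx
  rw [hp.flip_getVert hi]
  exact p.getVert_mem_support _

theorem IsPath.flip_involutive (hp : p.IsPath) : Function.Involutive p.flip := by
  intro x
  by_cases hx : x ∈ p.support
  · obtain ⟨i, hi, rfl⟩ := exists_getVert_eq hx
    rw [hp.flip_getVert hi, hp.flip_getVert (Nat.sub_le _ _), Nat.sub_sub_self hi]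
  · rw [flip_eq_self hx, flip_eq_self hx]

end Walk

/-- The situation of a generalized graph shift. -/
structure IsGGSPath (p : G.Walk u v) : Prop where
  ne : u ≠ v
  isPath : p.IsPath
  ncard_eq_two : ∀ x ∈ p.support, x ≠ u → x ≠ v → (G.neighborSet x).ncard = 2
  no_cycle : ∀ (a : V) (c : G.Walk a a), c.IsCycle → ¬ (u ∈ c.support ∧ v ∈ c.support)

namespace IsGGSPath

variable {p : G.Walk u v}

theorem length_pos (h : IsGGSPath p) : 0 < p.length :=
  Nat.pos_of_ne_zero fun h0 => h.ne (Walk.eq_of_length_eq_zero h0)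

theorem ncard_getVert (h : IsGGSPath p) {i : ℕ} (h0 : 0 < i) (hi : i < p.length) :
    (G.neighborSet (p.getVert i)).ncard = 2 := by
  refine h.ncard_eq_two _ (p.getVert_mem_support i) (fun hu => ?_) (fun hv => ?_)
  · have := h.isPath.getVert_inj hi.le (Nat.zero_le _) (hu.trans p.getVert_zero.symm)
    omega
  · have := h.isPath.getVert_inj hi.le le_rfl (hv.trans p.getVert_length.symm)
    omega

theorem eq_or_eq_of_adj (h : IsGGSPath p) {i : ℕ} (h0 : 0 < i) (hi : i < p.length) {x : V}
    (hx : G.Adj (p.getVert i) x) : x = p.getVert (i - 1) ∨ x = p.getVert (i + 1) := by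
  have hne : p.getVert (i - 1) ≠ p.getVert (i + 1) := fun he => by
    have := h.isPath.getVert_inj (by omega) (by omega) he
    omega
  have hfin : (G.neighborSet (p.getVert i)).Finite :=
    Set.finite_of_ncard_ne_zero (by rw [h.ncard_getVert h0 hi]; omega)
  have hsub : {p.getVert (i - 1), p.getVert (i + 1)} ⊆ G.neighborSet (p.getVert i) := by
    rintro y (rfl | rfl)
    · exact p.adj_getVert_pred h0 hi.le
    · exact p.adj_getVert_succ hi
  have heq := Set.eq_of_subset_of_ncard_le hsub
    (by rw [h.ncard_getVert h0 hi, Set.ncard_pair hne]) hfin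
  have hx' : x ∈ ({p.getVert (i - 1), p.getVert (i + 1)} : Set V) := heq ▸ hx
  simpa using hx'

theorem adj_penultimate (h : IsGGSPath p) : G.Adj v p.penultimate := by
  have := p.adj_getVert_pred h.length_pos le_rfl
  rwa [p.getVert_length] at this

/-- A cycle through this edge would be forced back along the degree-2 vertices to `u`, and so
contain both `u` and `v`. -/
theorem isBridge (h : IsGGSPath p) : G.IsBridge s(v, p.penultimate) := by
  rw [isBridge_iff_forall_cycle_notMem (G.mem_edgeSet.2 h.adj_penultimate)]
  intro a c hc he
  have hv := c.fst_mem_support_of_mem_edges he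
  have hw := c.snd_mem_support_of_mem_edges he
  have hall : ∀ j, j + 1 ≤ p.length → p.getVert (p.length - (j + 1)) ∈ c.support := by
    intro j
    induction j with
    | zero => exact fun _ => hw
    | succ j ih =>
      intro hj
      have h0 : 0 < p.length - (j + 1) := by omega
      have hlt : p.length - (j + 1) < p.length := by omega
      exact hc.mem_support_of_adj_of_ncard_eq_two (ih (by omega)) (h.ncard_getVert h0 hlt)
        (p.adj_getVert_pred h0 hlt.le)
  have hu := hall (p.length - 1) (by have := h.length_pos; omega)
  have hlen : p.length - (p.length - 1 + 1) = 0 := by omega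
  rw [hlen, p.getVert_zero] at hu
  exact h.no_cycle a c hc ⟨hu, hv⟩

theorem getVert_ne_right (h : IsGGSPath p) {i : ℕ} (hi : i < p.length) : p.getVert i ≠ v := by
  intro he
  have := h.isPath.getVert_inj hi.le le_rfl (he.trans p.getVert_length.symm)
  omega

theorem reachable_getVert (h : IsGGSPath p) (j : ℕ) (hj : j + 1 ≤ p.length) :
    (G.deleteEdges {s(v, p.penultimate)}).Reachable p.penultimate
      (p.getVert (p.length - (j + 1))) := by
  induction j with
  | zero => exact Reachable.refl _
  | succ j ih =>
    refine (ih (by omega)).trans (Adj.reachable ?_)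
    have hlt : p.length - (j + 1) < p.length := by omega
    rw [deleteEdges_adj]
    refine ⟨p.adj_getVert_pred (by omega) hlt.le, fun he => ?_⟩
    have hv : v ∈ s(p.getVert (p.length - (j + 1)), p.getVert (p.length - (j + 1 + 1))) := by
      rw [Set.mem_singleton_iff.1 he]
      exact Sym2.mem_mk_left _ _
    rcases Sym2.mem_iff.1 hv with hv | hv
    · exact h.getVert_ne_right hlt hv.symm
    · exact h.getVert_ne_right (by omega) hv.symm

/-- With the bridge removed, the rest of the path remains joined to `p.penultimate` and is thus cut
off from `v`. -/
theorem notMem_branch (h : IsGGSPath p) {x : V} (hx : x ∈ p.support) :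
    x ∉ G.branch v p.penultimate := by
  rintro ⟨hxv, hreach⟩
  obtain ⟨i, hi, rfl⟩ := Walk.exists_getVert_eq hx
  have hne : i ≠ p.length := by
    rintro rfl
    exact hxv p.getVert_length
  have hw := h.reachable_getVert (p.length - 1 - i) (by omega)
  have hidx : p.length - (p.length - 1 - i + 1) = i := by omega
  rw [hidx] at hw
  exact isBridge_iff.1 h.isBridge (hreach.trans hw.symm)

theorem eq_succ_of_adj (h : IsGGSPath p) {i j : ℕ} (hij : i < j) (hj : j ≤ p.length)
    (hadj : G.Adj (p.getVert i) (p.getVert j)) : j = i + 1 := by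
  by_cases hi : 0 < i
  · rcases h.eq_or_eq_of_adj hi (by omega) hadj with he | he <;>
    have := h.isPath.getVert_inj (by omega) (by omega) he <;> omega
  by_cases hjl : j < p.length
  · rcases h.eq_or_eq_of_adj (by omega) hjl hadj.symm with he | he <;>
    have := h.isPath.getVert_inj (by omega) (by omega) he <;> omega
  -- The only possible chord joins `u` to `v`; on a path of length above 1 it would put `u` in the
  -- branch.
  obtain rfl : i = 0 := by omega
  obtain rfl : j = p.length := by omega
  by_contra hne
  rw [p.getVert_length, p.getVert_zero] at hadj
  refine h.notMem_branch p.start_mem_support (mem_branch_of_adj hadj.symm fun he => hne ?_)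
  have := h.isPath.getVert_inj (Nat.zero_le _) (Nat.sub_le _ _) (p.getVert_zero.trans he)
  omega

theorem adj_flip (h : IsGGSPath p) {x y : V} (hx : x ∈ p.support) (hy : y ∈ p.support)
    (hxy : G.Adj x y) : G.Adj (p.flip x) (p.flip y) := by
  obtain ⟨i, hi, rfl⟩ := Walk.exists_getVert_eq hx
  obtain ⟨j, hj, rfl⟩ := Walk.exists_getVert_eq hy
  rw [h.isPath.flip_getVert hi, h.isPath.flip_getVert hj]
  rcases lt_trichotomy i j with hij | rfl | hij
  · obtain rfl := h.eq_succ_of_adj hij hj hxy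
    have := p.adj_getVert_pred (i := p.length - i) (by omega) (by omega)
    rwa [Nat.sub_sub] at this
  · exact absurd rfl hxy.ne
  · obtain rfl := h.eq_succ_of_adj hij hi hxy.symm
    have := p.adj_getVert_pred (i := p.length - j) (by omega) (by omega)
    rw [Nat.sub_sub] at this
    exact this.symm

theorem moveNeighbors_adj {w x y : V} (hxy : (G.moveNeighbors u v w).Adj x y) :
    (G.Adj x y ∧ ¬ ∃ z ∈ G.neighborSet v \ {w}, s(x, y) = s(v, z)) ∨
      ∃ z ∈ G.neighborSet v \ {w}, s(x, y) = s(u, z) := by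
  rw [moveNeighbors, fromEdgeSet_adj] at hxy
  exact hxy.1

theorem isBranchShift (h : IsGGSPath p) :
    IsBranchShift G (G.moveNeighbors u v p.penultimate) u v {x | x ∈ p.support}
      (G.branch v p.penultimate) h.isPath.flip_involutive.toPerm where
  left_mem := p.start_mem_support
  right_mem := p.end_mem_support
  notMem _ hi := h.notMem_branch hi
  involutive := h.isPath.flip_involutive
  map_left := by
    have := h.isPath.flip_getVert (Nat.zero_le _)
    rwa [p.getVert_zero, Nat.sub_zero, p.getVert_length] at this
  map_mem _ hi := h.isPath.flip_mem hi
  map_eq _ hi := Walk.flip_eq_self hi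
  adj_map _ hi _ hj := h.adj_flip hi hj
  adj_leave x hx y hy hxy := by
    obtain ⟨i, hi, rfl⟩ := Walk.exists_getVert_eq hx
    by_cases h0 : i = 0
    · subst h0
      left
      refine ⟨p.getVert_zero, fun hyY => ?_⟩
      exact h.notMem_branch hx (mem_branch_of_adj_branch hyY
        (by rw [p.getVert_zero]; exact h.ne) hxy.symm)
    by_cases hl : i = p.length
    · subst hl
      right
      rw [p.getVert_length] at hxy
      refine ⟨p.getVert_length, mem_branch_of_adj hxy ?_⟩
      rintro rfl
      exact hy (p.getVert_mem_support _)
    · rcases h.eq_or_eq_of_adj (by omega) (by omega) hxy with rfl | rfl <;>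
      exact absurd (p.getVert_mem_support _) hy
  adj_out x hx y hy hxy := by
    rcases moveNeighbors_adj hxy with h' | ⟨z, hz, he⟩
    · exact h'.1
    · have hzY := mem_branch_of_adj hz.1 hz.2
      have : z ∈ s(x, y) := he ▸ Sym2.mem_mk_right _ _
      rcases Sym2.mem_iff.1 this with rfl | rfl
      · exact absurd hzY hx
      · exact absurd hzY hy
  adj_in x hx y hy hxy := by
    rcases moveNeighbors_adj hxy with h' | ⟨z, hz, he⟩
    · exact h'.1
    · have hu := h.notMem_branch p.start_mem_support
      have : u ∈ s(x, y) := he ▸ Sym2.mem_mk_left _ _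
      rcases Sym2.mem_iff.1 this with rfl | rfl
      · exact absurd hx hu
      · exact absurd hy hu
  adj_cross x hx y hy hxy := by
    rcases moveNeighbors_adj hxy with ⟨hadj, hno⟩ | ⟨z, hz, he⟩
    · obtain rfl : y = v := by
        by_contra hyv
        exact hy (mem_branch_of_adj_branch hx hyv hadj)
      -- Every edge of `G` from `v` into the branch has been moved, because `p.penultimate` is not
      -- in the branch.
      refine absurd ⟨x, ⟨hadj.symm, ?_⟩, Sym2.eq_swap⟩ hno
      rintro rfl
      exact h.notMem_branch (p.getVert_mem_support _) hx
    · have hzY := mem_branch_of_adj hz.1 hz.2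
      have hu := h.notMem_branch p.start_mem_support
      rcases Sym2.eq_iff.1 he with ⟨rfl, rfl⟩ | ⟨rfl, rfl⟩
      · exact absurd hx hu
      · exact ⟨rfl, hz.1.symm⟩

end IsGGSPath

end SimpleGraph

/-! ### Bipartiteness of the shifted graph, and the theorem -/

theorem IsBranchShift.isBipartite {n : ℕ} {G H : SimpleGraph (Fin n)} {u v : Fin n}
    {P Y : Set (Fin n)} {ρ : Equiv.Perm (Fin n)} (h : IsBranchShift G H u v P Y ρ)
    (hG : G.IsBipartite) : H.IsBipartite := by
  classical
  obtain ⟨c⟩ := hG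
  -- Colours are added modulo 2: the branch is recoloured exactly when `u` and `v` have different
  -- colours.
  refine ⟨SimpleGraph.Coloring.mk (fun x => if x ∈ Y then c x + c v + c u else c x) ?_⟩
  have key : ∀ a d e : Fin 2, a ≠ d → a + d + e ≠ e := by decide
  have hcross : ∀ x ∈ Y, ∀ y ∉ Y, H.Adj x y → c x + c v + c u ≠ c y := by
    intro x hx y hy hxy
    obtain ⟨rfl, hxv⟩ := h.adj_cross x hx y hy hxy
    exact key _ _ _ (c.valid hxv)
  intro x y hxy
  by_cases hx : x ∈ Y <;> by_cases hy : y ∈ Y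
  · simpa [hx, hy] using c.valid (h.adj_in x hx y hy hxy)
  · simpa only [if_pos hx, if_neg hy] using hcross x hx y hy hxy
  · simpa only [if_pos hy, if_neg hx] using (hcross y hy x hx hxy.symm).symm
  · simpa [hx, hy] using c.valid (h.adj_out x hx y hy hxy)

end

theorem theorem1p2 {n : ℕ} (G : SimpleGraph (Fin n)) [DecidableRel G.Adj] (hG : G.IsBipartite)
    (lam : n.Partition) (r : ℕ) (hr : r ≤ n) :
    (∃ b : ℕ, lapImmCoeff lam r G = b) ∧
      ∀ (H : SimpleGraph (Fin n)) [DecidableRel H.Adj], G.IsGGS H →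
        ∃ b b' : ℕ, lapImmCoeff lam r G = b ∧ lapImmCoeff lam r H = b' ∧ b' ≤ b := by
  constructor
  · choose m hm using exists_nat_followSum lam
    rw [lapImmCoeff_eq_sum hG lam hr]
    exact ⟨_, by simp only [hm]; exact (Nat.cast_sum _ _).symm⟩
  · rintro H _ ⟨u, v, p, huv, hp, hdeg, hcyc, rfl⟩
    have h := SimpleGraph.IsGGSPath.isBranchShift (p := p) ⟨huv, hp, hdeg, hcyc⟩
    rw [lapImmCoeff_eq_sum hG lam hr, lapImmCoeff_eq_sum (h.isBipartite hG) lam hr]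
    exact h.exists_nat_sum_followSum_le huv lam r
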